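/- In the open online dial-a-ride problem on the half-line, a server of capacity $c\in\{1,2,3,\dots\}\cup\{\infty\}$ starts at time $0$ in the origin of $[0,\infty)$ and moves at speed at most $1$. Requests $(a,b;t)$ with $a,b,t\in[0,\infty)$ arrive over time; $(a,b;t)$ becomes known at its release time $t$, and the server has to load it at $a$ at a time $\ge t$ and unload it at $b$. It never has more than $c$ requests on board, may unload a request only at its destination, and may finish anywhere. For a finite request sequence $\sigma$, $\mathrm{Alg}(\sigma)$ is the time at which an algorithm $\mathrm{Alg}$ has served all requests, and $\mathrm{Opt}(\sigma)$ is the least completion time of an offline schedule. The competitive ratio of $\mathrm{Alg}$ is $\inf\{\rho\ge 1 : \mathrm{Alg}(\sigma)\le\rho\,\mathrm{Opt}(\sigma)\text{ for all }\sigma\}$. Let $\mathrm{Opt}(t)$ denote the optimum for the requests released not later than time $t$. For $\alpha\ge 0$, the algorithm $\mathrm{Lazy}(\alpha)$ works as follows, where $t$ is the current time. Upon receiving a request: if the server can deliver all requests on board and return to the origin until time $\alpha\cdot\mathrm{Opt}(t)$, it aborts what it is doing, delivers all requests on board and returns to the origin in the fastest possible way. Whenever the server is idle: if $t<\alpha\cdot\mathrm{Opt}(t)$,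 it waits at its position until time $\alpha\cdot\mathrm{Opt}(t)$; otherwise, if there are released requests that are not yet served, it starts to follow a shortest schedule from its position that serves all of them. **Theorem.** For every $\alpha\ge 0$ and every capacity $c\in\{1,2,3,\dots\}\cup\{\infty\}$, $\mathrm{Lazy}(\alpha)$ has competitive ratio at least $\frac{3+\sqrt3}{2}\approx 2.366$ for the open online dial-a-ride problem on the half-line, no matter how ties between shortest schedules are broken. -/

import Mathlib

open scoped Finset

noncomputable section

namespace DialARide

/-- A transportation request `(src, dst; release)` on the half-line `[0, ∞)`. -/
structure Request where
  src : ℝ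
  dst : ℝ
  release : ℝ
  src_nonneg : 0 ≤ src
  dst_nonneg : 0 ≤ dst
  release_nonneg : 0 ≤ release

/-- A finite request sequence, listed in the order of arrival. -/
structure RequestSeq where
  n : ℕ
  req : Fin n → Request
  sorted : Monotone fun i => (req i).release

/-- The actions of the server: go to the source of request `i` and load it, go to the destination
of request `i` and unload it, or go to the origin. -/
inductive Stop (n : ℕ) : Type
  | load (i : Fin n)
  | unload (i : Fin n)
  | origin

/-- The point at which an action takes place. -/
def Stop.loc (σ : RequestSeq) : Stop σ.n → ℝ
  | .load i => (σ.req i).src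
  | .unload i => (σ.req i).dst
  | .origin => 0

/-- `Serves c W L p`: starting with the requests `L` on board, the sequence of actions `p` picks up
every request of `W`, delivers all requests of `W` and `L`, touches no other request, never unloads
a request anywhere but at its destination, and never has more than `c` requests on board. -/
def Serves {n : ℕ} (c : ℕ∞) (W L : Finset (Fin n)) : List (Stop n) → Prop
  | [] => W = ∅ ∧ L = ∅
  | .load i :: p => i ∈ W ∧ ((#L + 1 : ℕ) : ℕ∞) ≤ c ∧ Serves c (W.erase i) (insert i L) p
  | .unload i :: p => i ∈ L ∧ Serves c W (L.erase i) p
  | .origin :: _ => False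

/-- The distance travelled by a server that starts at `x` and carries out the actions `p`; it is the
time that `p` takes when there is no need to wait for release times. -/
def travel (σ : RequestSeq) (x : ℝ) : List (Stop σ.n) → ℝ
  | [] => 0
  | a :: p => |x - a.loc σ| + travel σ (a.loc σ) p

/-- The time at which a server that is at `x` at time `t` completes the actions `p` if it moves at
unit speed, loads no request before its release time, and wastes no time otherwise. -/
def completion (σ : RequestSeq) (x t : ℝ) : List (Stop σ.n) → ℝ
  | [] => t
  | .load i :: p =>
      completion σ (σ.req i).src (max (t + |x - (σ.req i).src|) (σ.req i).release) p
  | .unload i :: p => completion σ (σ.req i).dst (t + |x - (σ.req i).dst|) p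
  | .origin :: p => completion σ 0 (t + |x|) p

/-- The least completion time of an offline schedule that starts in the origin at time `0` and
serves the requests in `A`. -/
def optOn (c : ℕ∞) (σ : RequestSeq) (A : Finset (Fin σ.n)) : ℝ :=
  sInf {T | ∃ p, Serves c A ∅ p ∧ T = completion σ 0 0 p}

/-- `Opt(σ)`. -/
def opt (c : ℕ∞) (σ : RequestSeq) : ℝ := optOn c σ Finset.univ

/-- `Opt(t)`: the optimum for the requests that are released not later than time `t`. -/
def optAt (c : ℕ∞) (σ : RequestSeq) (t : ℝ) : ℝ :=
  optOn c σ (Finset.univ.filter fun i => (σ.req i).release ≤ t)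

/-- `p` is a shortest schedule `S(R, x)` that starts from `x`, with nothing on board, and serves
`R`, release times being ignored. -/
def IsShortestSchedule (c : ℕ∞) (σ : RequestSeq) (R : Finset (Fin σ.n)) (x : ℝ)
    (p : List (Stop σ.n)) : Prop :=
  Serves c R ∅ p ∧ ∀ q, Serves c R ∅ q → travel σ x p ≤ travel σ x q

/-- `p` delivers the requests `L` that are on board and then returns to the origin, in the fastest
possible way from `x`. -/
def IsFastestReturn (c : ℕ∞) (σ : RequestSeq) (L : Finset (Fin σ.n)) (x : ℝ)
    (p : List (Stop σ.n)) : Prop :=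
  ∃ q, p = q ++ [.origin] ∧ Serves c ∅ L q ∧
    ∀ q', Serves c ∅ L q' → travel σ x p ≤ travel σ x (q' ++ [.origin])

/-- A rule that fixes which of the shortest schedules, and which of the fastest ways to deliver and
return, the server uses. The choice may depend on the current time and on the request sequence. -/
structure TieBreaking (c : ℕ∞) where
  schedule (σ : RequestSeq) (t : ℝ) (R : Finset (Fin σ.n)) (x : ℝ) : List (Stop σ.n)
  deliverAndReturn (σ : RequestSeq) (t : ℝ) (L : Finset (Fin σ.n)) (x : ℝ) : List (Stop σ.n)
  schedule_spec : ∀ σ t R x, IsShortestSchedule c σ R x (schedule σ t R x)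
  deliverAndReturn_spec : ∀ σ t L x, IsFastestReturn c σ L x (deliverAndReturn σ t L x)

theorem Serves.length_eq {n : ℕ} {c : ℕ∞} {p : List (Stop n)} : ∀ {W L : Finset (Fin n)},
    Serves c W L p → p.length = 2 * #W + #L ∨ (W ∩ L).Nonempty := by
  induction p with
  | nil => rintro W L ⟨rfl, rfl⟩; simp
  | cons a p ih =>
    intro W L h
    by_cases hd : (W ∩ L).Nonempty
    · exact .inr hd
    have hd' : Disjoint W L := by
      rwa [Finset.disjoint_iff_inter_eq_empty, ← Finset.not_nonempty_iff_eq_empty]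
    left
    cases a with
    | load i =>
      obtain ⟨hi, -, h⟩ := h
      have hiL : i ∉ L := fun h' => (Finset.disjoint_left.1 hd' hi h')
      rcases ih h with h | ⟨j, hj⟩
      · have := Finset.card_erase_add_one hi
        rw [Finset.card_insert_of_notMem hiL] at h
        simp; omega
      · rw [Finset.mem_inter, Finset.mem_erase, Finset.mem_insert] at hj
        obtain ⟨⟨h1, h2⟩, h3⟩ := hj
        exact absurd (h3.resolve_left h1) (Finset.disjoint_left.1 hd' h2)
    | unload i =>
      obtain ⟨hi, h⟩ := h
      rcases ih h with h | ⟨j, hj⟩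
      · have := Finset.card_erase_add_one hi
        simp; omega
      · simp at hj
        exact absurd hj.2.2 (Finset.disjoint_left.1 hd' hj.1)
    | origin => exact h.elim

theorem exists_serves {n : ℕ} {c : ℕ∞} (hc : 1 ≤ c) (R : Finset (Fin n)) : ∃ p, Serves c R ∅ p := by
  induction R using Finset.induction_on with
  | empty => exact ⟨[], rfl, rfl⟩
  | insert i s hi ih =>
    obtain ⟨p, hp⟩ := ih
    refine ⟨.load i :: .unload i :: p, ?_⟩
    simpa [Serves, hi] using ⟨hc, hp⟩

theorem exists_serves' {n : ℕ} {c : ℕ∞} (R : Finset (Fin n)) : ∃ p, Serves c ∅ R p := by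
  induction R using Finset.induction_on with
  | empty => exact ⟨[], rfl, rfl⟩
  | insert i s hi ih =>
    obtain ⟨p, hp⟩ := ih
    refine ⟨.unload i :: p, ?_⟩
    simpa [Serves, hi] using hp

theorem finite_stop (n : ℕ) : Finite (Stop n) :=
  Finite.of_surjective (fun x : Option (Fin n ⊕ Fin n) => match x with
    | none => Stop.origin | some (.inl i) => .load i | some (.inr i) => .unload i)
    (by rintro (i | i | _); exacts [⟨some (.inl i), rfl⟩, ⟨some (.inr i), rfl⟩, ⟨none, rfl⟩])

theorem finite_serves {n : ℕ} {c : ℕ∞} {W L : Finset (Fin n)} (h : W ∩ L = ∅) :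
    {p : List (Stop n) | Serves c W L p}.Finite :=
  have := finite_stop n
  (List.finite_length_eq (Stop n) (2 * #W + #L)).subset fun p hp =>
    (Serves.length_eq hp).resolve_right (by simp [h])

/-- For every positive capacity, tie-breaking rules exist. -/
theorem TieBreaking.nonempty {c : ℕ∞} (hc : 1 ≤ c) : Nonempty (TieBreaking c) := by
  have h1 : ∀ (σ : RequestSeq) (R : Finset (Fin σ.n)) x, ∃ p, IsShortestSchedule c σ R x p := by
    intro σ R x
    obtain ⟨p, hp, h⟩ := Set.exists_min_image _ (travel σ x)
      (finite_serves (c := c) (W := R) (L := ∅) (by simp))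
      (exists_serves hc R)
    exact ⟨p, hp, h⟩
  have h2 : ∀ (σ : RequestSeq) (R : Finset (Fin σ.n)) x, ∃ p, IsFastestReturn c σ R x p := by
    intro σ R x
    obtain ⟨p, hp, h⟩ := Set.exists_min_image _ (fun q => travel σ x (q ++ [.origin]))
      (finite_serves (c := c) (W := ∅) (L := R) (by simp))
      (exists_serves' R)
    exact ⟨_, p, rfl, hp, h⟩
  choose f hf using h1
  choose g hg using h2
  exact ⟨⟨fun σ _ => f σ, fun σ _ => g σ, fun σ _ => hf σ, fun σ _ => hg σ⟩⟩

/-- The state of the online server. The list `plan` holds the actions that remain of the command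
being executed; it is empty when the server is idle or waiting. -/
structure State (n : ℕ) where
  time : ℝ
  pos : ℝ
  /-- requests that have been received but not yet loaded -/
  waiting : Finset (Fin n)
  /-- requests that are loaded -/
  onboard : Finset (Fin n)
  plan : List (Stop n)
  /-- the time of the last delivery so far -/
  lastDelivery : ℝ

/-- At time `0` the server is idle in the origin. -/
def State.start (n : ℕ) : State n := ⟨0, 0, ∅, ∅, [], 0⟩

/-- The state after going straight to the place of the action `a` and carrying it out there. -/
def State.perform {σ : RequestSeq} (s : State σ.n) (a : Stop σ.n) : State σ.n :=
  let t := s.time + |s.pos - a.loc σ|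
  let s' := { s with time := t, pos := a.loc σ }
  match a with
  | .load i => { s' with waiting := s.waiting.erase i, onboard := insert i s.onboard }
  | .unload i => { s' with onboard := s.onboard.erase i, lastDelivery := t }
  | .origin => s'

/-- The state after executing, from state `s`, the actions in the given list for `τ` time units at
unit speed (and standing still once all of them are completed). -/
def State.follow {σ : RequestSeq} (s : State σ.n) : List (Stop σ.n) → ℝ → State σ.n
  | [], τ => { s with time := s.time + τ, plan := [] }
  | a :: p, τ =>
      if |s.pos - a.loc σ| ≤ τ then (s.perform a).follow p (τ - |s.pos - a.loc σ|)
      else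
        { s with
          time := s.time + τ
          pos := if s.pos ≤ a.loc σ then s.pos + τ else s.pos - τ
          plan := a :: p }

/-- The state at the moment at which the current command is completed. -/
def State.complete {σ : RequestSeq} (s : State σ.n) : State σ.n :=
  s.follow s.plan (travel σ s.pos s.plan)

/-- Standing still until time `T` (if it is not over yet). -/
def State.waitUntil {n : ℕ} (s : State n) (T : ℝ) : State n := { s with time := max s.time T }

/-- An idle server starts a shortest schedule for the unserved requests if there are any. -/
def State.startSchedule {c : ℕ∞} (rule : TieBreaking c) {σ : RequestSeq} (s : State σ.n) :
    State σ.n :=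
  if s.waiting.Nonempty then { s with plan := rule.schedule σ s.time s.waiting s.pos } else s

/-- What happens while no request arrives: the server completes its current command, is idle, waits
until time `α * Opt(t)` if this is not over, and starts a new schedule. This is the state at the
moment at which that schedule starts. -/
def State.nextSchedule (α : ℝ) {c : ℕ∞} (rule : TieBreaking c) {σ : RequestSeq} (s : State σ.n) :
    State σ.n :=
  (s.complete.waitUntil (α * optAt c σ s.time)).startSchedule rule

/-- The evolution of the server from an arrival (or from time `0`) until the time `T` of the next
arrival, just before that request is received: `T` may come while the current command is being
executed, or before the next schedule is started, or during or after the next schedule. -/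
def State.runUntil (α : ℝ) {c : ℕ∞} (rule : TieBreaking c) {σ : RequestSeq} (s : State σ.n)
    (T : ℝ) : State σ.n :=
  if T ≤ s.complete.time then s.follow s.plan (T - s.time)
  else if T ≤ (s.nextSchedule α rule).time then s.complete.waitUntil T
  else (s.nextSchedule α rule).follow (s.nextSchedule α rule).plan
    (T - (s.nextSchedule α rule).time)

/-- Upon receiving request `i` at the current time: if the server can serve all loaded requests and
return to the origin until time `α * Opt(t)`, it aborts what it is doing and does so. -/
def State.receive (α : ℝ) {c : ℕ∞} (rule : TieBreaking c) {σ : RequestSeq} (s : State σ.n)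
    (i : Fin σ.n) : State σ.n :=
  let p := rule.deliverAndReturn σ s.time s.onboard s.pos
  if s.time + travel σ s.pos p ≤ α * optAt c σ s.time then
    { s with waiting := insert i s.waiting, plan := p }
  else { s with waiting := insert i s.waiting }

/-- The state of the server just after the arrival of the last request. -/
def lazyState (α : ℝ) {c : ℕ∞} (rule : TieBreaking c) (σ : RequestSeq) : State σ.n :=
  (List.finRange σ.n).foldl
    (fun s i => (s.runUntil α rule (σ.req i).release).receive α rule i) (State.start σ.n)

/-- The completion time of the algorithm `Lazy(α)` on the request sequence `σ`: after the last
arrival, the server completes its current command and then one more schedule. -/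
def lazy (α : ℝ) {c : ℕ∞} (rule : TieBreaking c) (σ : RequestSeq) : ℝ :=
  ((lazyState α rule σ).nextSchedule α rule).complete.lastDelivery

/-- The competitive ratio `inf {ρ ≥ 1 | Alg(σ) ≤ ρ * Opt(σ) for all σ}` of an algorithm with
completion times `alg` for capacity `c`; it is `⊤` if there is no such `ρ`. -/
def competitiveRatio (c : ℕ∞) (alg : RequestSeq → ℝ) : EReal :=
  ⨅ ρ ∈ {ρ : ℝ | 1 ≤ ρ ∧ ∀ σ, alg σ ≤ ρ * opt c σ}, (ρ : EReal)

end DialARide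

end

/-! Three adversarial inputs cover all `α`. For `α ≥ (1 + √3) / 2`, waiting alone is too expensive:
one request at the point 1, released at time 0, is served at time `α + 1` instead of 1
(`lazy_one_request`).

For smaller `α`, the server is lured into a tour that ends in the origin, and a request far to the
right arrives once the tour can no longer be aborted in time. In `lazy_three_requests` the requests
`1 → 0` and `0 → Y`, with `Y` slightly below 2, make every shortest tour end in the origin, with
length `2 * Y`. Just after the start at time `2 * Y * α`, while the request to `Y` is on board, a
request appears at a point `q`. The server reaches it only at time `2 * Y * α + 2 * Y + q`, whereas
the offline server takes the other order, ends the first two requests at `Y` and is at `q` at time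
`2 + q`. With `q ≈ 4 * α - 2` and `Y → 2` the ratio tends to `2 + 1 / (2 * α)`. This decreases in
`α` and equals `1 + α` exactly at `α = (1 + √3) / 2`, which is where the bound `(3 + √3) / 2` comes
from.

The choice of `q` requires `q ≥ Y`, hence essentially `α ≥ 1`. For `9 / 10 ≤ α ≤ 1` the fixed value
`q = 2` suffices, and for `α ≤ 9 / 10` the four requests of `lazy_four_requests` do. All distances
are chosen so that the shortest schedules are unique or equally bad, so tie-breaking has no
influence. -/

namespace DialARide

/-! ### Bounds on the optimum, and enumeration of the schedules for at most two requests. -/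

section Schedules

variable {σ : RequestSeq} {c : ℕ∞}

theorem travel_nonneg (x : ℝ) (p : List (Stop σ.n)) : 0 ≤ travel σ x p := by
  induction p generalizing x with
  | nil => exact le_rfl
  | cons a p ih => exact add_nonneg (abs_nonneg _) (ih _)

theorem add_travel_le_completion (x t : ℝ) (p : List (Stop σ.n)) :
    t + travel σ x p ≤ completion σ x t p := by
  induction p generalizing x t with
  | nil => simp [travel, completion]
  | cons a p ih =>
    cases a with
    | load i =>
      have h := ih (σ.req i).src (max (t + |x - (σ.req i).src|) (σ.req i).release)
      have := le_max_left (t + |x - (σ.req i).src|) (σ.req i).release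
      simp only [travel, completion, Stop.loc]
      linarith
    | unload i =>
      have h := ih (σ.req i).dst (t + |x - (σ.req i).dst|)
      simp only [travel, completion, Stop.loc]
      linarith
    | origin =>
      have h := ih 0 (t + |x|)
      simp only [travel, completion, Stop.loc, sub_zero]
      linarith

theorem completion_nonneg (p : List (Stop σ.n)) : 0 ≤ completion σ 0 0 p :=
  (add_nonneg le_rfl (travel_nonneg 0 p)).trans (add_travel_le_completion 0 0 p)

theorem optOn_nonneg (A : Finset (Fin σ.n)) : 0 ≤ optOn c σ A :=
  Real.sInf_nonneg (by rintro _ ⟨p, -, rfl⟩; exact completion_nonneg p)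

theorem optOn_le {A : Finset (Fin σ.n)} {p : List (Stop σ.n)} (hp : Serves c A ∅ p) :
    optOn c σ A ≤ completion σ 0 0 p :=
  csInf_le ⟨0, by rintro _ ⟨p, -, rfl⟩; exact completion_nonneg p⟩ ⟨p, hp, rfl⟩

/-- Waiting for release times only delays a schedule, so its pure travel distance bounds its
completion time from below. Existence of a schedule matters because `sInf ∅ = 0`. -/
theorem le_optOn (hc : 1 ≤ c) {A : Finset (Fin σ.n)} {T : ℝ}
    (h : ∀ p, Serves c A ∅ p → T ≤ travel σ 0 p) : T ≤ optOn c σ A := by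
  obtain ⟨p, hp⟩ := exists_serves hc A
  refine le_csInf ⟨_, p, hp, rfl⟩ ?_
  rintro _ ⟨p, hp, rfl⟩
  have := add_travel_le_completion 0 0 p
  linarith [h p hp]

theorem serves_empty {n : ℕ} {p : List (Stop n)} (h : Serves c ∅ ∅ p) : p = [] := by
  rcases p with - | ⟨a | a | -, p⟩ <;> simp_all [Serves]

theorem serves_onboard_singleton {n : ℕ} {i : Fin n} {p : List (Stop n)}
    (h : Serves c ∅ {i} p) : p = [.unload i] := by
  rcases p with - | ⟨a | a | -, p⟩
  · simp [Serves] at h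
  · simp [Serves] at h
  · obtain ⟨h1, h2⟩ := h
    obtain rfl := Finset.mem_singleton.1 h1
    rw [Finset.erase_singleton] at h2
    rw [serves_empty h2]
  · exact h.elim

theorem serves_onboard_pair {n : ℕ} {i j : Fin n} (hij : i ≠ j) {p : List (Stop n)}
    (h : Serves c ∅ {i, j} p) : p = [.unload i, .unload j] ∨ p = [.unload j, .unload i] := by
  rcases p with - | ⟨a | a | -, p⟩
  · simp [Serves] at h
  · simp [Serves] at h
  · obtain ⟨h1, h2⟩ := h
    rcases (by simpa using h1 : a = i ∨ a = j) with rfl | rfl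
    · rw [Finset.erase_insert (by simpa using hij)] at h2
      exact .inl (by rw [serves_onboard_singleton h2])
    · rw [Finset.pair_comm, Finset.erase_insert (by simpa using hij.symm)] at h2
      exact .inr (by rw [serves_onboard_singleton h2])
  · exact h.elim

theorem serves_singleton {n : ℕ} {i : Fin n} {p : List (Stop n)}
    (h : Serves c {i} ∅ p) : p = [.load i, .unload i] := by
  rcases p with - | ⟨a | a | -, p⟩
  · simp [Serves] at h
  · obtain ⟨h1, -, h2⟩ := h
    obtain rfl := Finset.mem_singleton.1 h1
    rw [Finset.erase_singleton] at h2
    rw [serves_onboard_singleton h2]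
  · simp [Serves] at h
  · exact h.elim

theorem serves_singleton_singleton {n : ℕ} {i j : Fin n} (hij : i ≠ j) {p : List (Stop n)}
    (h : Serves c {j} {i} p) : p = [.unload i, .load j, .unload j] ∨
      p = [.load j, .unload i, .unload j] ∨ p = [.load j, .unload j, .unload i] := by
  rcases p with - | ⟨a | a | -, p⟩
  · simp [Serves] at h
  · obtain ⟨h1, -, h2⟩ := h
    obtain rfl := Finset.mem_singleton.1 h1
    rw [Finset.erase_singleton] at h2
    rcases serves_onboard_pair hij.symm h2 with rfl | rfl <;> simp
  · obtain ⟨h1, h2⟩ := h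
    obtain rfl := Finset.mem_singleton.1 h1
    rw [Finset.erase_singleton] at h2
    simp [serves_singleton h2]
  · exact h.elim

theorem serves_pair {n : ℕ} {i j : Fin n} (hij : i ≠ j) {p : List (Stop n)}
    (h : Serves c {i, j} ∅ p) :
    (p = [.load i, .unload i, .load j, .unload j] ∨ p = [.load i, .load j, .unload i, .unload j] ∨
      p = [.load i, .load j, .unload j, .unload i]) ∨
    (p = [.load j, .unload j, .load i, .unload i] ∨ p = [.load j, .load i, .unload j, .unload i] ∨
      p = [.load j, .load i, .unload i, .unload j]) := by
  rcases p with - | ⟨a | a | -, p⟩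
  · simp [Serves] at h
  · obtain ⟨h1, -, h2⟩ := h
    rcases (by simpa using h1 : a = i ∨ a = j) with rfl | rfl
    · rw [Finset.erase_insert (by simpa using hij)] at h2
      left
      rcases serves_singleton_singleton hij h2 with rfl | rfl | rfl <;> simp
    · rw [Finset.pair_comm, Finset.erase_insert (by simpa using hij.symm)] at h2
      right
      rcases serves_singleton_singleton hij.symm h2 with rfl | rfl | rfl <;> simp
  · simp [Serves] at h
  · exact h.elim

theorem TieBreaking.schedule_singleton (rule : TieBreaking c) (t x : ℝ) (i : Fin σ.n) :
    rule.schedule σ t {i} x = [.load i, .unload i] :=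
  serves_singleton (rule.schedule_spec σ t {i} x).1

theorem TieBreaking.deliverAndReturn_empty (rule : TieBreaking c) (t x : ℝ) :
    rule.deliverAndReturn σ t ∅ x = [.origin] := by
  obtain ⟨q, h, hq, -⟩ := rule.deliverAndReturn_spec σ t ∅ x
  rw [h, serves_empty hq, List.nil_append]

theorem TieBreaking.deliverAndReturn_singleton (rule : TieBreaking c) (t x : ℝ) (i : Fin σ.n) :
    rule.deliverAndReturn σ t {i} x = [.unload i, .origin] := by
  obtain ⟨q, h, hq, -⟩ := rule.deliverAndReturn_spec σ t {i} x
  rw [h, serves_onboard_singleton hq, List.singleton_append]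

end Schedules

/-! ### Symbolic execution of the online server. -/

namespace State

variable {σ : RequestSeq} {c : ℕ∞} {α : ℝ}

theorem follow_nil (s : State σ.n) (τ : ℝ) :
    s.follow (σ := σ) [] τ = { s with time := s.time + τ, plan := [] } := rfl

theorem follow_cons_of_le {s : State σ.n} {a : Stop σ.n} {τ : ℝ} (p : List (Stop σ.n))
    (h : |s.pos - a.loc σ| ≤ τ) :
    s.follow (a :: p) τ = (s.perform a).follow p (τ - |s.pos - a.loc σ|) := by
  rw [follow, if_pos h]

theorem follow_cons_of_lt {s : State σ.n} {a : Stop σ.n} {τ : ℝ} (p : List (Stop σ.n))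
    (h : s.pos + τ < a.loc σ) :
    s.follow (a :: p) τ = ⟨s.time + τ, if s.pos ≤ a.loc σ then s.pos + τ else s.pos - τ, s.waiting,
      s.onboard, a :: p, s.lastDelivery⟩ := by
  rw [follow, if_neg]
  rw [not_le, abs_sub_comm]
  exact (by linarith : τ < a.loc σ - s.pos).trans_le (le_abs_self _)

theorem follow_travel_cons (s : State σ.n) (a : Stop σ.n) (p : List (Stop σ.n)) :
    s.follow (a :: p) (travel σ s.pos (a :: p)) =
      (s.perform a).follow p (travel σ (a.loc σ) p) := by
  rw [follow_cons_of_le p (by simpa [travel] using travel_nonneg _ p)]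
  simp [travel]

theorem perform_load (t x l : ℝ) (W L : Finset (Fin σ.n)) (P : List (Stop σ.n)) (i : Fin σ.n) :
    (⟨t, x, W, L, P, l⟩ : State σ.n).perform (σ := σ) (.load i) =
      ⟨t + |x - (σ.req i).src|, (σ.req i).src, W.erase i, insert i L, P, l⟩ := rfl

theorem perform_unload (t x l : ℝ) (W L : Finset (Fin σ.n)) (P : List (Stop σ.n)) (i : Fin σ.n) :
    (⟨t, x, W, L, P, l⟩ : State σ.n).perform (σ := σ) (.unload i) =
      ⟨t + |x - (σ.req i).dst|, (σ.req i).dst, W, L.erase i, P, t + |x - (σ.req i).dst|⟩ := rfl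

theorem perform_origin (t x l : ℝ) (W L : Finset (Fin σ.n)) (P : List (Stop σ.n)) :
    (⟨t, x, W, L, P, l⟩ : State σ.n).perform (σ := σ) .origin =
      ⟨t + |x|, 0, W, L, P, l⟩ := by
  simp [perform, Stop.loc]

/-- The end of a command: all its actions are performed one after the other. -/
theorem complete_eq_foldl (s : State σ.n) :
    s.complete (σ := σ) = { s.plan.foldl (perform (σ := σ)) s with plan := [] } := by
  have key : ∀ (p : List (Stop σ.n)) (s : State σ.n),
      s.follow p (travel σ s.pos p) = { p.foldl (perform (σ := σ)) s with plan := [] } := by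
    intro p
    induction p with
    | nil => intro s; simp [follow_nil, travel]
    | cons a p ih =>
      intro s
      have hp : (s.perform a).pos = a.loc σ := by cases a <;> rfl
      rw [follow_travel_cons, List.foldl_cons, ← ih, hp]
  exact key _ _

theorem runUntil_start (rule : TieBreaking c) :
    (start σ.n).runUntil (σ := σ) α rule 0 = start σ.n := by
  simp [runUntil, start, complete, follow_nil, travel]

/-- A request that arrives while the server rests in the origin. -/
theorem receive_at_origin (hα : 0 ≤ α) (rule : TieBreaking c) (W : Finset (Fin σ.n))
    (P : List (Stop σ.n)) (l : ℝ) (i : Fin σ.n) :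
    (⟨0, 0, W, ∅, P, l⟩ : State σ.n).receive (σ := σ) α rule i =
      ⟨0, 0, insert i W, ∅, [.origin], l⟩ := by
  have h : 0 ≤ α * optAt c σ 0 := mul_nonneg hα (optOn_nonneg _)
  simp [receive, rule.deliverAndReturn_empty, travel, Stop.loc, h]

theorem complete_at_origin (W : Finset (Fin σ.n)) (l : ℝ) :
    (⟨0, 0, W, ∅, [.origin], l⟩ : State σ.n).complete (σ := σ) = ⟨0, 0, W, ∅, [], l⟩ := by
  simp [complete_eq_foldl, perform_origin]

theorem runUntil_zero_at_origin (rule : TieBreaking c) (W : Finset (Fin σ.n)) (l : ℝ) :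
    (⟨0, 0, W, ∅, [.origin], l⟩ : State σ.n).runUntil (σ := σ) α rule 0 = ⟨0, 0, W, ∅, [], l⟩ := by
  rw [runUntil, complete_at_origin, if_pos le_rfl, follow_cons_of_le] <;>
    simp [Stop.loc, perform_origin, follow_nil]

theorem nextSchedule_at_origin (hα : 0 ≤ α) (rule : TieBreaking c) {W : Finset (Fin σ.n)}
    (hW : W.Nonempty) (l : ℝ) :
    (⟨0, 0, W, ∅, [.origin], l⟩ : State σ.n).nextSchedule (σ := σ) α rule =
      ⟨α * optAt c σ 0, 0, W, ∅, rule.schedule σ (α * optAt c σ 0) W 0, l⟩ := by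
  have h : 0 ≤ α * optAt c σ 0 := mul_nonneg hα (optOn_nonneg _)
  simp [nextSchedule, complete_at_origin, waitUntil, startSchedule, hW, h]

theorem runUntil_at_origin (hα : 0 ≤ α) (rule : TieBreaking c) {W : Finset (Fin σ.n)}
    (hW : W.Nonempty) (l : ℝ) {T : ℝ} (hT : α * optAt c σ 0 < T) :
    (⟨0, 0, W, ∅, [.origin], l⟩ : State σ.n).runUntil (σ := σ) α rule T =
      (⟨α * optAt c σ 0, 0, W, ∅, rule.schedule σ (α * optAt c σ 0) W 0, l⟩ : State σ.n).follow
        (rule.schedule σ (α * optAt c σ 0) W 0) (T - α * optAt c σ 0) := by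
  have h : 0 ≤ α * optAt c σ 0 := mul_nonneg hα (optOn_nonneg _)
  rw [runUntil, complete_at_origin, nextSchedule_at_origin hα rule hW]
  rw [if_neg (by simpa using h.trans_lt hT), if_neg (by simpa using hT)]

theorem receive_of_lt (rule : TieBreaking c) {s : State σ.n} (i : Fin σ.n)
    (h : α * optAt c σ s.time <
      s.time + travel σ s.pos (rule.deliverAndReturn σ s.time s.onboard s.pos)) :
    s.receive (σ := σ) α rule i = { s with waiting := insert i s.waiting } := by
  rw [receive, if_neg (not_le.2 h)]

/-- If a single request is left, then its delivery follows the completion of the current command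
and the transfer to its source. -/
theorem le_lastDelivery (rule : TieBreaking c) {s : State σ.n} {i : Fin σ.n}
    (hw : (s.complete (σ := σ)).waiting = {i}) :
    (s.complete (σ := σ)).time + |(s.complete (σ := σ)).pos - (σ.req i).src| ≤
      ((s.nextSchedule (σ := σ) α rule).complete (σ := σ)).lastDelivery := by
  have h1 := le_max_left (s.complete (σ := σ)).time (α * optAt c σ s.time)
  have h2 := abs_nonneg ((σ.req i).src - (σ.req i).dst)
  have hn : ({i} : Finset (Fin σ.n)).Nonempty := ⟨i, by simp⟩
  rw [complete_eq_foldl (nextSchedule α rule s)]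
  simp only [nextSchedule, waitUntil, startSchedule, hw, hn, if_true, rule.schedule_singleton,
    List.foldl_cons, List.foldl_nil, perform_load, perform_unload]
  linarith

end State

/-! ### The three adversarial request sequences. -/

section LowerBounds

variable {σ : RequestSeq} {c : ℕ∞} {α : ℝ}

theorem mem_of_finRange_eq {l : List (Fin σ.n)} (h : List.finRange σ.n = l) (i : Fin σ.n) :
    i ∈ l := h ▸ List.mem_finRange i

theorem lazy_one_request (hc : 1 ≤ c) (hα : 0 ≤ α) (rule : TieBreaking c) {i : Fin σ.n}
    (hσ : List.finRange σ.n = [i]) (hs : (σ.req i).src = 1) (hd : (σ.req i).dst = 1)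
    (hr : (σ.req i).release = 0) : α + 1 ≤ lazy α rule σ ∧ opt c σ ≤ 1 := by
  have hu : (Finset.univ : Finset (Fin σ.n)) = {i} := by
    ext j; simpa using mem_of_finRange_eq hσ j
  have h0 : 1 ≤ optAt c σ 0 := by
    refine le_optOn hc fun p hp => ?_
    rw [hu, Finset.filter_singleton, if_pos hr.le] at hp
    rw [serves_singleton hp]
    simp [travel, Stop.loc, hs, hd]
  constructor
  · rw [lazy, lazyState, hσ, List.foldl_cons, List.foldl_nil, hr, State.runUntil_start,
      State.start, State.receive_at_origin hα, State.nextSchedule_at_origin hα _ ⟨i, by simp⟩,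
      State.complete_eq_foldl]
    simp only [insert_empty_eq, rule.schedule_singleton, List.foldl_cons, List.foldl_nil,
      State.perform_load, State.perform_unload, hs, hd]
    norm_num
    nlinarith
  · refine (optOn_le (p := [.load i, .unload i]) ?_).trans ?_
    · rw [hu]
      simpa [Serves] using hc
    · simp [completion, hs, hd, hr]

/-- The single `ε` has two roles: it keeps `Y` below 2, and it delays the last request until the
server has loaded `j`. The condition `hqr` says that the offline server reaches `q` no earlier than
the release, `hq` that it need not turn back after `Y`, and `hret` that the online server can no
longer return in time. -/
theorem lazy_three_requests (hc : 1 ≤ c) (hα : 9 / 10 ≤ α) (rule : TieBreaking c)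
    {i j k : Fin σ.n} (hσ : List.finRange σ.n = [i, j, k]) {Y q ε : ℝ}
    (hε : 0 < ε) (hε1 : ε ≤ 1 / 100) (hY : Y = 2 - ε) (hq : Y ≤ q) (hqr : 2 * Y * α + ε - 2 ≤ q)
    (hret : α * (2 + q) < 2 * Y * (α + 1))
    (his : (σ.req i).src = 1) (hid : (σ.req i).dst = 0) (hir : (σ.req i).release = 0)
    (hjs : (σ.req j).src = 0) (hjd : (σ.req j).dst = Y) (hjr : (σ.req j).release = 0)
    (hks : (σ.req k).src = q) (hkd : (σ.req k).dst = q)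
    (hkr : (σ.req k).release = 2 * Y * α + ε) :
    2 * Y * α + 2 * Y + q ≤ lazy α rule σ ∧ opt c σ ≤ 2 + q := by
  have hu : (Finset.univ : Finset (Fin σ.n)) = {i, j, k} := by
    ext l; simpa using mem_of_finRange_eq hσ l
  have hnd : [i, j, k].Nodup := hσ ▸ List.nodup_finRange _
  obtain ⟨⟨hij, hik⟩, hjk⟩ : (i ≠ j ∧ i ≠ k) ∧ j ≠ k := by simpa using hnd
  have hα0 : 0 ≤ α := by linarith
  have hYa : 0 < 2 * Y * α := by subst hY; nlinarith
  have hf0 : (Finset.univ.filter fun l => (σ.req l).release ≤ 0) = {i, j} := by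
    rw [hu]
    ext l
    simp only [Finset.mem_filter, Finset.mem_insert, Finset.mem_singleton]
    constructor
    · rintro ⟨rfl | rfl | rfl, h⟩
      · simp
      · simp
      · linarith
    · rintro (rfl | rfl) <;> simp [hir, hjr]
  have hfr : (Finset.univ.filter fun l => (σ.req l).release ≤ 2 * Y * α + ε) = {i, j, k} := by
    rw [← hu, Finset.filter_true_of_mem]
    intro l _
    have : l = i ∨ l = j ∨ l = k := by simpa using mem_of_finRange_eq hσ l
    rcases this with rfl | rfl | rfl <;> linarith
  have h1Y : 1 < Y := by linarith
  have habs : |1 - Y| = Y - 1 := by rw [abs_sub_comm, abs_of_pos (by linarith)]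
  have hab0 : |Y| = Y := abs_of_pos (by linarith)
  have hjips : Serves c {i, j} ∅ [.load j, .unload j, .load i, .unload i] := by
    simpa [Serves, hij, hij.symm, Finset.erase_insert_of_ne] using hc
  have ht0 : travel σ 0 [.load j, .unload j, .load i, .unload i] = 2 * Y := by
    simp [travel, Stop.loc, his, hid, hjs, hjd, hab0, abs_sub_comm Y 1, habs]
    ring
  -- the shortest schedules
  have hshort : ∀ p, Serves c {i, j} ∅ p → (p = [.load j, .unload j, .load i, .unload i] ∨
      p = [.load j, .load i, .unload j, .unload i]) ∨ 2 * Y < travel σ 0 p := by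
    intro p hp
    -- Each of the four other orders has length at least `2 + Y`, which exceeds `2 * Y` because `Y <
    -- 2`.
    rcases serves_pair hij hp with (rfl | rfl | rfl) | rfl | rfl | rfl
    all_goals first | exact .inl (.inl rfl) | exact .inl (.inr rfl) | right
    all_goals simp [travel, Stop.loc, his, hid, hjs, hjd, hab0]; linarith
  have ht1 : travel σ 0 [.load j, .load i, .unload j, .unload i] = 2 * Y := by
    simp [travel, Stop.loc, his, hid, hjs, hjd, hab0, habs]
    ring
  have hopt0 : optAt c σ 0 = 2 * Y := by
    apply le_antisymm
    · rw [optAt, hf0]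
      refine (optOn_le hjips).trans ?_
      simp [completion, his, hid, hir, hjs, hjd, hjr, hab0, abs_sub_comm Y 1, habs]
      rw [max_eq_left (by linarith)]
      linarith
    · refine le_optOn hc fun p hp => ?_
      rw [hf0] at hp
      rcases hshort p hp with (rfl | rfl) | h
      · exact ht0.ge
      · exact ht1.ge
      · exact h.le
  have hoptr : optOn c σ {i, j, k} ≤ 2 + q := by
    -- The order rejected by the online server: 2 time units for `i`, then rightwards only, through
    -- `Y` to `q`.
    refine (optOn_le (p := [.load i, .unload i, .load j, .unload j, .load k, .unload k]) ?_).trans ?_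
    · simpa [Serves, hij, hij.symm, hik, hik.symm, hjk, hjk.symm, Finset.erase_insert_of_ne] using hc
    · simp [completion, his, hid, hir, hjs, hjd, hjr, hks, hkd, hkr, hab0, abs_sub_comm Y q,
        abs_of_nonneg (sub_nonneg.2 hq)]
      constructor <;> linarith
  refine ⟨?_, by rwa [opt, hu]⟩
  rw [lazy, lazyState, hσ, List.foldl_cons, List.foldl_cons, List.foldl_cons, List.foldl_nil,
    hir, hjr, hkr, State.runUntil_start, State.start, State.receive_at_origin hα0,
    State.runUntil_zero_at_origin, State.receive_at_origin hα0,
    insert_empty_eq, Finset.pair_comm j i,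
    State.runUntil_at_origin hα0 rule (W := {i, j}) (Finset.insert_nonempty _ _)
      0 (T := 2 * Y * α + ε) (by rw [hopt0]; linarith)]
  rw [hopt0]
  obtain ⟨hS, hSmin⟩ := rule.schedule_spec σ (α * (2 * Y)) {i, j} 0
  have hS' := (hshort _ hS).resolve_right (not_lt.2 ((hSmin _ hjips).trans ht0.le))
  generalize rule.schedule σ (α * (2 * Y)) {i, j} 0 = S at hS'
  have hτ : 2 * Y * α + ε - α * (2 * Y) = ε := by ring
  rw [hτ]
  -- the server is on its way when the last request arrives
  obtain ⟨P, hP, hPS⟩ : ∃ P, (P = [.unload j, .load i, .unload i] ∨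
      P = [.load i, .unload j, .unload i]) ∧
      (⟨α * (2 * Y), 0, {i, j}, ∅, S, 0⟩ : State σ.n).follow (σ := σ) S ε =
        ⟨2 * Y * α + ε, ε, {i}, {j}, P, 0⟩ := by
    have he : ({i, j} : Finset (Fin σ.n)).erase j = {i} := by
      rw [Finset.pair_comm, Finset.erase_insert (by simpa using hij.symm)]
    rcases hS' with rfl | rfl
    · refine ⟨_, .inl rfl, ?_⟩
      rw [State.follow_cons_of_le _ (by simp [Stop.loc, hjs, hε.le]), State.perform_load,
        State.follow_cons_of_lt _ (by simp [Stop.loc, hjs, hjd]; linarith)]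
      simp [Stop.loc, hjs, hjd, he, (by linarith : (0:ℝ) ≤ Y)]
      ring
    · refine ⟨_, .inr rfl, ?_⟩
      rw [State.follow_cons_of_le _ (by simp [Stop.loc, hjs, hε.le]), State.perform_load,
        State.follow_cons_of_lt _ (by simp [Stop.loc, hjs, his]; linarith)]
      simp [Stop.loc, hjs, his, he]
      ring
  -- With `j` on board, the fastest return goes via `Y` and ends at time `2 * Y * α + 2 * Y`, too
  -- late by `hret`. The tour therefore continues.
  rw [hPS, State.receive_of_lt]
  swap
  · have h1 : |ε - Y| = Y - ε := by rw [abs_sub_comm, abs_of_pos (by linarith)]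
    simp only [rule.deliverAndReturn_singleton, travel, Stop.loc, hjd, h1, optAt, hfr, sub_zero,
      hab0]
    nlinarith
  have hcomp : (⟨2 * Y * α + ε, ε, insert k {i}, {j}, P, 0⟩ : State σ.n).complete (σ := σ) =
      ⟨2 * Y * α + 2 * Y, 0, {k}, ∅, [], 2 * Y * α + 2 * Y⟩ := by
    have h1 : |ε - Y| = Y - ε := by rw [abs_sub_comm, abs_of_pos (by linarith)]
    have h2 : |ε - 1| = 1 - ε := by rw [abs_sub_comm, abs_of_pos (by linarith)]
    have he : ({k, i} : Finset (Fin σ.n)).erase i = {k} := by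
      rw [Finset.pair_comm, Finset.erase_insert (by simpa using hik)]
    have he' : ({i, j} : Finset (Fin σ.n)).erase j = {i} := by
      rw [Finset.pair_comm, Finset.erase_insert (by simpa using hij.symm)]
    rw [State.complete_eq_foldl]
    rcases hP with rfl | rfl
    · simp [State.perform_load, State.perform_unload, his, hid, hjd, h1, abs_sub_comm Y 1, habs, he]
      ring
    · simp [State.perform_load, State.perform_unload, his, hid, hjd, h2, hab0, habs, he, he']
      ring
  refine le_trans ?_ (State.le_lastDelivery rule (i := k) (by rw [hcomp]))
  rw [hcomp, hks]
  simp [le_abs_self]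

/-- While `i` is carried to 1, requests appear at both 0 and `y`. From 1 it is shorter to visit `y`
first, as `y < 2`, so the server goes to `y` and then to 0. A second request at `y`, arriving while
the server is on its way to `y`, then costs another trip of length `y`. The offline server stays in
the origin until `j` is released and then walks right once. -/
theorem lazy_four_requests (hc : 1 ≤ c) (hα0 : 0 ≤ α) (hα : α ≤ 9 / 10) (rule : TieBreaking c)
    {i j k m : Fin σ.n} (hσ : List.finRange σ.n = [i, j, k, m]) {y : ℝ} (hy : y = 199 / 100)
    (his : (σ.req i).src = 0) (hid : (σ.req i).dst = 1) (hir : (σ.req i).release = 0)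
    (hjs : (σ.req j).src = 0) (hjd : (σ.req j).dst = 0) (hjr : (σ.req j).release = α + 1 / 100)
    (hks : (σ.req k).src = y) (hkd : (σ.req k).dst = y) (hkr : (σ.req k).release = α + 1 / 100)
    (hms : (σ.req m).src = y) (hmd : (σ.req m).dst = y) (hmr : (σ.req m).release = α + 7 / 4) :
    α + 3 * y ≤ lazy α rule σ ∧ opt c σ ≤ α + 2 := by
  have hu : (Finset.univ : Finset (Fin σ.n)) = {i, j, k, m} := by
    ext l; simpa using mem_of_finRange_eq hσ l
  have hnd : [i, j, k, m].Nodup := hσ ▸ List.nodup_finRange _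
  obtain ⟨⟨hij, hik, him⟩, ⟨hjk, hjm⟩, hkm⟩ :
    (i ≠ j ∧ i ≠ k ∧ i ≠ m) ∧ (j ≠ k ∧ j ≠ m) ∧ k ≠ m := by simpa using hnd
  have hf0 : (Finset.univ.filter fun l => (σ.req l).release ≤ 0) = {i} := by
    rw [hu]
    ext l
    simp only [Finset.mem_filter, Finset.mem_insert, Finset.mem_singleton]
    constructor
    · rintro ⟨rfl | rfl | rfl | rfl, h⟩
      · simp
      all_goals linarith
    · rintro rfl
      simp [hir]
  have hf1 : (Finset.univ.filter fun l => (σ.req l).release ≤ α + 1 / 100) = {i, j, k} := by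
    rw [hu]
    ext l
    simp only [Finset.mem_filter, Finset.mem_insert, Finset.mem_singleton]
    constructor
    · rintro ⟨rfl | rfl | rfl | rfl, h⟩
      · simp
      · simp
      · simp
      · linarith
    · rintro (rfl | rfl | rfl)
      · exact ⟨by simp, by linarith⟩
      · exact ⟨by simp, hjr.le⟩
      · exact ⟨by simp, hkr.le⟩
  have hf2 : (Finset.univ.filter fun l => (σ.req l).release ≤ α + 7 / 4) = {i, j, k, m} := by
    rw [← hu, Finset.filter_true_of_mem]
    intro l _
    have : l = i ∨ l = j ∨ l = k ∨ l = m := by simpa using mem_of_finRange_eq hσ l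
    rcases this with rfl | rfl | rfl | rfl <;> linarith
  have hopt0 : optAt c σ 0 = 1 := by
    rw [optAt, hf0]
    apply le_antisymm
    · refine (optOn_le (p := [.load i, .unload i]) (by simpa [Serves] using hc)).trans ?_
      simp [completion, his, hid, hir]
    · refine le_optOn hc fun p hp => ?_
      rw [serves_singleton hp]
      simp [travel, Stop.loc, his, hid]
  have hy1 : |1 - y| = 99 / 100 := by rw [hy]; norm_num [abs_of_neg]
  have hoptα : α * optAt c σ (α + 1 / 100) ≤ α * (α + 2) := by
    refine mul_le_mul_of_nonneg_left ?_ hα0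
    rw [optAt, hf1]
    refine (optOn_le (p := [.load j, .unload j, .load i, .unload i, .load k, .unload k]) ?_).trans ?_
    · simpa [Serves, hij, hij.symm, hik, hik.symm, hjk, hjk.symm, Finset.erase_insert_of_ne] using hc
    · simp [completion, his, hid, hir, hjs, hjd, hjr, hks, hkd, hkr, hy1]
      rw [max_eq_right (by positivity : (0 : ℝ) ≤ α + 100⁻¹)]
      norm_num
      linarith
  have hopt2 : optOn c σ {i, j, k, m} ≤ α + 2 := by
    refine (optOn_le (p := [.load j, .unload j, .load i, .unload i, .load k, .unload k,
      .load m, .unload m]) ?_).trans ?_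
    · simpa [Serves, hij, hij.symm, hik, hik.symm, hjk, hjk.symm, him, him.symm, hjm, hjm.symm,
        hkm, hkm.symm, Finset.erase_insert_of_ne] using hc
    · simp [completion, his, hid, hir, hjs, hjd, hjr, hks, hkd, hkr, hms, hmd, hmr, hy1]
      rw [max_eq_right (by positivity : (0 : ℝ) ≤ α + 100⁻¹)]
      norm_num
      linarith
  -- Equality holds at `α = 9 / 10`. Since `171 / 100 < 7 / 4`, the waiting period ends before the
  -- last request arrives.
  have hαα : α * (α + 2) ≤ α + 171 / 100 := by nlinarith
  refine ⟨?_, by rwa [opt, hu]⟩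
  rw [lazy, lazyState, hσ, List.foldl_cons, List.foldl_cons, List.foldl_cons, List.foldl_cons,
    List.foldl_nil, hir, hjr, hkr, hmr, State.runUntil_start, State.start,
    State.receive_at_origin hα0,
    insert_empty_eq,
    State.runUntil_at_origin hα0 rule (W := {i}) (Finset.singleton_nonempty _)
      0 (T := α + 1 / 100) (by rw [hopt0]; linarith)]
  rw [hopt0, rule.schedule_singleton, mul_one,
    State.follow_cons_of_le _ (by simp [Stop.loc, his]), State.perform_load,
    State.follow_cons_of_lt _ (by simp [Stop.loc, his, hid]; norm_num)]
  have e1 : (⟨α + |0 - (σ.req i).src| + (α + 1 / 100 - α - |0 - Stop.loc σ (Stop.load i)|),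
      if (σ.req i).src ≤ Stop.loc σ (Stop.unload i) then
        (σ.req i).src + (α + 1 / 100 - α - |0 - Stop.loc σ (Stop.load i)|)
      else (σ.req i).src - (α + 1 / 100 - α - |0 - Stop.loc σ (Stop.load i)|),
      ({i} : Finset (Fin σ.n)).erase i, insert i ∅, [.unload i], 0⟩ : State σ.n) =
      ⟨α + 1 / 100, 1 / 100, ∅, {i}, [.unload i], 0⟩ := by
    simp [Stop.loc, his, hid]
  -- no return to the origin is possible while request `i` is on board
  have hrec : ∀ (W : Finset (Fin σ.n)) (l : Fin σ.n),
      (⟨α + 1 / 100, 1 / 100, W, {i}, [.unload i], 0⟩ : State σ.n).receive (σ := σ) α rule l =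
        ⟨α + 1 / 100, 1 / 100, insert l W, {i}, [.unload i], 0⟩ := by
    intro W l
    rw [State.receive_of_lt]
    simp only [rule.deliverAndReturn_singleton, travel, Stop.loc, hid]
    norm_num [abs_of_neg]
    linarith
  have hcomp1 : (⟨α + 1 / 100, 1 / 100, {k, j}, {i}, [.unload i], 0⟩ : State σ.n).complete
      (σ := σ) = ⟨α + 1, 1, {k, j}, ∅, [], α + 1⟩ := by
    rw [State.complete_eq_foldl]
    simp [State.perform_unload, hid]
    norm_num [abs_of_neg]
    ring
  have hrun : (⟨α + 1 / 100, 1 / 100, {j}, {i}, [.unload i], 0⟩ : State σ.n).runUntil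
      (σ := σ) α rule (α + 1 / 100) = ⟨α + 1 / 100, 1 / 100, {j}, {i}, [.unload i], 0⟩ := by
    have hcomp : (⟨α + 1 / 100, 1 / 100, {j}, {i}, [.unload i], 0⟩ : State σ.n).complete
        (σ := σ) = ⟨α + 1, 1, {j}, ∅, [], α + 1⟩ := by
      rw [State.complete_eq_foldl]
      simp [State.perform_unload, hid]
      norm_num [abs_of_neg]
      ring
    rw [State.runUntil, hcomp, if_pos (by simp; norm_num), State.follow_cons_of_lt _ (by
      simp [Stop.loc, hid]; norm_num)]
    simp
  rw [e1, hrec, insert_empty_eq, hrun, hrec]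
  have hyy : |y| = 199 / 100 := by rw [hy]; norm_num
  -- Visiting `y` first costs `2 * y - 1 = 2.98`, visiting 0 first costs at least `1 + y = 2.99`.
  have hS : ∀ t, rule.schedule σ t {k, j} 1 = [.load k, .unload k, .load j, .unload j] := by
    intro t
    obtain ⟨h1, h2⟩ := rule.schedule_spec σ t {k, j} 1
    have h3 := h2 [.load k, .unload k, .load j, .unload j]
      (by simpa [Serves, hjk, hjk.symm, Finset.erase_insert_of_ne] using hc)
    rcases serves_pair hjk.symm h1 with (h | h | h) | h | h | h
    · exact h
    all_goals
      rw [h] at h3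
      norm_num [travel, Stop.loc, hjs, hjd, hks, hkd, hyy, hy1] at h3
  obtain ⟨t, ht1, ht2, hnext⟩ : ∃ t, α + 1 ≤ t ∧ t ≤ α + 171 / 100 ∧
      (⟨α + 1 / 100, 1 / 100, {k, j}, {i}, [.unload i], 0⟩ : State σ.n).nextSchedule (σ := σ) α rule =
        ⟨t, 1, {k, j}, ∅, [.load k, .unload k, .load j, .unload j], α + 1⟩ := by
    refine ⟨max (α + 1) (α * optAt c σ (α + 1 / 100)), le_max_left _ _,
      max_le (by linarith) (by linarith), ?_⟩
    rw [State.nextSchedule, hcomp1]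
    simp [State.waitUntil, State.startSchedule, hS]
  have hrun2 : (⟨α + 1 / 100, 1 / 100, {k, j}, {i}, [.unload i], 0⟩ : State σ.n).runUntil
      (σ := σ) α rule (α + 7 / 4) = ⟨α + 7 / 4, 1 + (α + 7 / 4 - t), {k, j}, ∅,
        [.load k, .unload k, .load j, .unload j], α + 1⟩ := by
    -- As `t ≥ α + 1`, the server is at most at `7 / 4 < y` when `m` arrives, so `k` is not loaded
    -- yet.
    rw [State.runUntil, hcomp1, hnext, if_neg (by simp; norm_num),
      if_neg (by simp; linarith),
      State.follow_cons_of_lt _ (by simp [Stop.loc, hks]; linarith)]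
    have : (1 : ℝ) ≤ y := by linarith
    simp [Stop.loc, hks, this]
  -- The server is empty, but the current time `α + 7 / 4` already exceeds the deadline, which is at
  -- most `α * (α + 2)`.
  rw [show insert k {j} = ({k, j} : Finset (Fin σ.n)) from rfl, hrun2, State.receive_of_lt]
  swap
  · simp only [rule.deliverAndReturn_empty, travel, Stop.loc, optAt, hf2, sub_zero, add_zero]
    have h1 := le_abs_self (1 + (α + 7 / 4 - t))
    have h2 := mul_le_mul_of_nonneg_left hopt2 hα0
    linarith
  have hcomp2 : (⟨α + 7 / 4, 1 + (α + 7 / 4 - t), insert m {k, j}, ∅,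
      [.load k, .unload k, .load j, .unload j], α + 1⟩ : State σ.n).complete (σ := σ) =
        ⟨t + 2 * y - 1, 0, {m}, ∅, [], t + 2 * y - 1⟩ := by
    have he : (({m, k, j} : Finset (Fin σ.n)).erase k).erase j = {m} := by
      ext l
      simp only [Finset.mem_erase, Finset.mem_insert, Finset.mem_singleton]
      constructor
      · tauto
      · rintro rfl
        exact ⟨hjm.symm, hkm.symm, .inl rfl⟩
    have h1 : |1 + (α + 7 / 4 - t) - y| = y - (1 + (α + 7 / 4 - t)) := by
      rw [abs_sub_comm, abs_of_nonneg (by linarith)]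
    rw [State.complete_eq_foldl]
    simp [State.perform_load, State.perform_unload, hjs, hjd, hks, hkd, he, h1, hyy]
    linarith
  refine le_trans ?_ (State.le_lastDelivery rule (i := m) (by rw [hcomp2]))
  rw [hcomp2, hms]
  simp only [zero_sub, abs_neg, hyy]
  linarith

end LowerBounds

/-! ### From the request sequences to the bound on the ratio. -/

section Ratio

variable {c : ℕ∞} {α ρ : ℝ}

theorem one_add_le_of_competitive (hc : 1 ≤ c) (hα : 0 ≤ α) (rule : TieBreaking c) (hρ1 : 1 ≤ ρ)
    (hρ : ∀ σ, lazy α rule σ ≤ ρ * opt c σ) : α + 1 ≤ ρ := by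
  obtain ⟨h1, h2⟩ := lazy_one_request hc hα rule (i := (0 : Fin 1))
    (σ := ⟨1, fun _ => ⟨1, 1, 0, by simp, by simp, le_rfl⟩, fun _ _ _ => le_rfl⟩) rfl rfl rfl rfl
  have := hρ ⟨1, fun _ => ⟨1, 1, 0, by simp, by simp, le_rfl⟩, fun _ _ _ => le_rfl⟩
  nlinarith

theorem three_requests_bound (hc : 1 ≤ c) (hα : 9 / 10 ≤ α) (rule : TieBreaking c) (hρ1 : 1 ≤ ρ)
    (hρ : ∀ σ, lazy α rule σ ≤ ρ * opt c σ) {Y q ε : ℝ}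
    (hε : 0 < ε) (hε1 : ε ≤ 1 / 100) (hY : Y = 2 - ε) (hq : Y ≤ q) (hqr : 2 * Y * α + ε - 2 ≤ q)
    (hret : α * (2 + q) < 2 * Y * (α + 1)) : 2 * Y * α + 2 * Y + q ≤ ρ * (2 + q) := by
  have hY0 : 0 ≤ Y := by linarith
  have hr : 0 ≤ 2 * Y * α + ε := by
    have : 0 ≤ α := by linarith
    positivity
  let σ : RequestSeq := ⟨3, ![⟨1, 0, 0, by simp, le_rfl, le_rfl⟩, ⟨0, Y, 0, le_rfl, hY0, le_rfl⟩,
    ⟨q, q, 2 * Y * α + ε, hY0.trans hq, hY0.trans hq, hr⟩], by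
      rw [Fin.monotone_iff_le_succ]
      intro i
      fin_cases i
      · exact le_rfl
      · exact hr⟩
  obtain ⟨h1, h2⟩ := lazy_three_requests hc hα rule (σ := σ) (i := (0 : Fin 3)) (j := (1 : Fin 3))
    (k := (2 : Fin 3)) rfl hε hε1 hY hq hqr hret rfl rfl rfl rfl rfl rfl rfl rfl rfl
  exact h1.trans ((hρ σ).trans (mul_le_mul_of_nonneg_left h2 (by linarith)))

theorem four_requests_bound (hc : 1 ≤ c) (hα0 : 0 ≤ α) (hα : α ≤ 9 / 10) (rule : TieBreaking c)
    (hρ1 : 1 ≤ ρ) (hρ : ∀ σ, lazy α rule σ ≤ ρ * opt c σ) :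
    α + 3 * (199 / 100) ≤ ρ * (α + 2) := by
  let σ : RequestSeq := ⟨4, ![⟨0, 1, 0, le_rfl, by simp, le_rfl⟩,
    ⟨0, 0, α + 1 / 100, le_rfl, le_rfl, by positivity⟩,
    ⟨199 / 100, 199 / 100, α + 1 / 100, by positivity, by positivity, by positivity⟩,
    ⟨199 / 100, 199 / 100, α + 7 / 4, by positivity, by positivity, by positivity⟩], by
      rw [Fin.monotone_iff_le_succ]
      intro i
      fin_cases i
      · show (0 : ℝ) ≤ α + 1 / 100
        positivity
      · exact le_rfl
      · show α + 1 / 100 ≤ α + 7 / 4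
        norm_num⟩
  obtain ⟨h1, h2⟩ := lazy_four_requests hc hα0 hα rule (σ := σ) (i := (0 : Fin 4))
    (j := (1 : Fin 4)) (k := (2 : Fin 4)) (m := (3 : Fin 4)) rfl rfl
    rfl rfl rfl rfl rfl rfl rfl rfl rfl rfl rfl rfl
  exact h1.trans ((hρ σ).trans (mul_le_mul_of_nonneg_left h2 (by linarith)))

/-- For `α` between `1` and `1.37`, the competitive ratio is at least `2 + 1 / (2 * α)`. -/
theorem two_add_inv_le_of_competitive (hc : 1 ≤ c) (hα : 1 ≤ α) (hα' : α ≤ 137 / 100)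
    (rule : TieBreaking c) (hρ1 : 1 ≤ ρ) (hρ : ∀ σ, lazy α rule σ ≤ ρ * opt c σ) :
    8 * α + 2 ≤ ρ * (4 * α) := by
  by_contra! h
  -- For `Y = 2 - ε` and `q = 2 * Y * α + ε - 2`, the online cost is `8 * α + 2 - ε * K` and the
  -- offline bound is `4 * α - ε * (2 * α - 1)`. The value of `ε` makes the loss `ε * K` at most
  -- half of the assumed gap.
  set K := 4 * α + 1
  have hK : 0 < K := by positivity
  set ε := min (1 / 100) ((8 * α + 2 - ρ * (4 * α)) / (2 * K))
  have hε : 0 < ε := lt_min (by norm_num) (div_pos (by linarith) (by positivity))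
  have hε1 : ε ≤ 1 / 100 := min_le_left _ _
  have hε2 : ε * (2 * K) ≤ 8 * α + 2 - ρ * (4 * α) :=
    (le_div_iff₀ (by positivity)).1 (min_le_right _ _)
  have := three_requests_bound hc (by linarith) rule hρ1 hρ hε hε1 rfl
    (q := 2 * (2 - ε) * α + ε - 2) (by nlinarith) le_rfl (by nlinarith)
  have h3 : 0 ≤ (ρ - 1) * (ε * (2 * α - 1)) :=
    mul_nonneg (by linarith) (mul_nonneg hε.le (by linarith))
  simp only [K] at hε2
  nlinarith [mul_pos hε hK]

theorem le_of_competitive (hc : 1 ≤ c) (hα : 0 ≤ α) (rule : TieBreaking c) (hρ1 : 1 ≤ ρ)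
    (hρ : ∀ σ, lazy α rule σ ≤ ρ * opt c σ) : (3 + √3) / 2 ≤ ρ := by
  have hs : √3 * √3 = 3 := Real.mul_self_sqrt (by norm_num)
  have hs1 : √3 ≤ 17321 / 10000 := Real.sqrt_le_iff.2 ⟨by norm_num, by norm_num⟩
  have hs0 := Real.sqrt_nonneg 3
  -- At this threshold `1 + α` and `2 + 1 / (2 * α)` coincide.
  rcases le_total ((1 + √3) / 2) α with h | h
  · linarith [one_add_le_of_competitive hc hα rule hρ1 hρ]
  rcases le_total α (9 / 10) with h9 | h9
  · have := four_requests_bound hc hα h9 rule hρ1 hρ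
    by_contra! hlt
    nlinarith
  rcases le_total α 1 with h1 | h1
  -- Here `2 * Y * α + ε - 2 ≤ Y`, so `q` is fixed at 2 instead. The ratio is at least `9.562 / 4 >
  -- 2.39`, which leaves room for a fixed `ε`.
  · have := three_requests_bound hc h9 rule hρ1 hρ (ε := 1 / 100) (q := 2) (by norm_num) le_rfl
      rfl (by norm_num) (by linarith) (by linarith)
    linarith
  · have := two_add_inv_le_of_competitive hc h1 (by linarith) rule hρ1 hρ
    by_contra! hlt
    nlinarith [mul_pos (by linarith : 0 < α) (sub_pos.2 hlt),
      mul_nonneg hs0 (sub_nonneg.2 h)]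

end Ratio

end DialARide

theorem theorem3 (α : ℝ) (hα : 0 ≤ α) (c : ℕ∞) (hc : 1 ≤ c) (rule : DialARide.TieBreaking c) :
    (((3 + Real.sqrt 3) / 2 : ℝ) : EReal) ≤
      DialARide.competitiveRatio c (DialARide.lazy α rule) :=
  le_iInf₂ fun _ hρ =>
    EReal.coe_le_coe_iff.2 (DialARide.le_of_competitive hc hα rule hρ.1 hρ.2)
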